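/- Let $n\ge 0$ be an integer and let $\mathcal H^n$ denote the $n$-dimensional Hausdorff measure on $\mathbb R^{n+1}$, normalized to agree with Lebesgue measure on $n$-planes. Write $B_r(x)$ for open Euclidean balls in $\mathbb R^{n+1}$. For $M\subset\mathbb R^{n+1}$ put $\mu=\mathcal H^n\llcorner M$, and write $-\!\!\!\!\!\!\int_{B} g\,d\mu=\frac1{\mu(B)}\int_{B} g\,d\mu$ for averages and $f_{x,r}=-\!\!\!\!\!\!\int_{B_r(x)}f\,d\mu$. Definitions. (a) $M$ is $n$-Ahlfors regular with constant $C_M\ge1$ if $M$ is closed and $C_M^{-1}r^n\le\mu(B_r(x))\le C_M r^n$ for all $x\in M$ and $0<r<1$. (b) $M$ is (countably $n$-)rectifiable if it is $\mathcal H^n$-measurable and $M\subset M_0\cup\bigcup_{i\ge1}f_i(A_i)$ with $\mathcal H^n(M_0)=0$, $A_i\subset\mathbb R^n$ and $f_i:A_i\to\mathbb R^{n+1}$ Lipschitz. (c) An $n$-dimensional linear subspace $P$ of $\mathbb R^{n+1}$ is the approximate tangent space $T_xM$ of $M$ at $x$ if $\lim_{\lambda\downarrow0}\lambda^{-n}\int_M\varphi(\lambda^{-1}(y-x))\,d\mathcal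 H^n(y)=\int_P\varphi\,d\mathcal H^n$ for all $\varphi\in C^1_c(\mathbb R^{n+1},\mathbb R)$. For rectifiable Ahlfors regular $M$ it exists at $\mu$-almost every $x$. (d) For $f:\mathbb R^{n+1}\to\mathbb R$ locally Lipschitz, $\nabla^Mf(y)$ is the gradient at $y$ of the restriction of $f$ to the affine subspace $y+T_yM$; for rectifiable Ahlfors regular $M$ it is defined for $\mu$-almost every $y$ (and is set equal to $0$ elsewhere). (e) $M$ satisfies the Poincaré-type inequality with constant $C_P$ if for all $x\in M$, all $r>0$ and all locally Lipschitz $f:\mathbb R^{n+1}\to\mathbb R$, $$-\!\!\!\!\!\!\int_{B_r(x)}|f(y)-f_{x,r}|\,d\mu(y)\le C_P\,r\left(-\!\!\!\!\!\!\int_{B_{2r}(x)}|\nabla^Mf(y)|^2\,d\mu(y)\right)^{1/2}.$$ (f) A metric space $(X,d)$ is $\kappa$-quasiconvex, $\kappa\ge1$, if any two points $x,y\in X$ can be joined by a rectifiable curve in $X$ of length at most $\kappa\,d(x,y)$. Theorem. For all $n$, $C_M$, $C_P$ there is a constant $\kappa=\kappa(n,C_M,C_P)\ge1$ such that every rectifiable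 set $M\subset B_1(0)\subset\mathbb R^{n+1}$ that is $n$-Ahlfors regular with constant $C_M$ and satisfies the Poincaré-type inequality with constant $C_P$ is, with the restriction of the Euclidean metric, $\kappa$-quasiconvex. -/

import Mathlib

open MeasureTheory Filter Topology

noncomputable section

/-- The Euclidean space `ℝ^d`. -/
abbrev Euc (d : ℕ) : Type := EuclideanSpace ℝ (Fin d)

/-- The measure `μ = ℋⁿ ⌞ M`, where `ℋⁿ` is the `n`-dimensional Hausdorff measure on `ℝ^{n+1}`
(normalized so that it is Lebesgue measure on `n`-planes). -/
def surfaceMeasure (n : ℕ) (M : Set (Euc (n + 1))) : Measure (Euc (n + 1)) :=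
  (μHE[n] : Measure (Euc (n + 1))).restrict M

/-- `M ⊆ ℝ^{n+1}` is countably `n`-rectifiable: it is `ℋⁿ`-measurable and, up to an `ℋⁿ`-null set,
covered by countably many Lipschitz images of subsets of `ℝⁿ`. -/
def IsCountablyRectifiable (n : ℕ) (M : Set (Euc (n + 1))) : Prop :=
  (μHE[n] : Measure (Euc (n + 1))).toOuterMeasure.IsCaratheodory M ∧
  ∃ (M₀ : Set (Euc (n + 1))) (A : ℕ → Set (Euc n)) (f : ℕ → Euc n → Euc (n + 1)),
    (μHE[n] : Measure (Euc (n + 1))) M₀ = 0 ∧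
    (∀ i, ∃ K : NNReal, LipschitzOnWith K (f i) (A i)) ∧
    M ⊆ M₀ ∪ ⋃ i, f i '' A i

/-- `M` is a (closed) `n`-Ahlfors regular subset of `ℝ^{n+1}` with regularity constant `C`:
`C⁻¹ rⁿ ≤ μ(B_r(x)) ≤ C rⁿ` for all `x ∈ M` and `0 < r < 1`. -/
structure IsAhlforsRegularSet (n : ℕ) (C : ℝ) (M : Set (Euc (n + 1))) : Prop where
  isClosed : IsClosed M
  one_le : 1 ≤ C
  lower : ∀ x ∈ M, ∀ r : ℝ, 0 < r → r < 1 →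
    ENNReal.ofReal (C⁻¹ * r ^ n) ≤ surfaceMeasure n M (Metric.ball x r)
  upper : ∀ x ∈ M, ∀ r : ℝ, 0 < r → r < 1 →
    surfaceMeasure n M (Metric.ball x r) ≤ ENNReal.ofReal (C * r ^ n)

/-- The `n`-dimensional linear subspace `P` of `ℝ^{n+1}` is the approximate tangent space of `M`
at `x`. -/
def IsApproxTangentSpace (n : ℕ) (M : Set (Euc (n + 1))) (x : Euc (n + 1))
    (P : Submodule ℝ (Euc (n + 1))) : Prop :=
  Module.finrank ℝ P = n ∧
  ∀ φ : Euc (n + 1) → ℝ, ContDiff ℝ 1 φ → HasCompactSupport φ →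
    Tendsto (fun t : ℝ => (t ^ n)⁻¹ * ∫ y in M, φ (t⁻¹ • (y - x)) ∂μHE[n])
      (𝓝[>] 0) (𝓝 (∫ y in (P : Set (Euc (n + 1))), φ y ∂μHE[n]))

open Classical in
/-- The approximate tangent space `T_x M`. By convention it is `{0}` at the points where no
approximate tangent space exists (an `ℋⁿ`-null subset of `M` if `M` is rectifiable and has locally
finite `ℋⁿ` measure). -/
def approxTangentSpace (n : ℕ) (M : Set (Euc (n + 1))) (x : Euc (n + 1)) :
    Submodule ℝ (Euc (n + 1)) :=
  if h : ∃ P, IsApproxTangentSpace n M x P then h.choose else ⊥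

/-- The gradient at `y` of the restriction of `f` to the affine subspace `y + T`, which is
parametrized isometrically by `v ↦ y + v`, `v ∈ T`. It is a vector of `T`, and it is `0` by
convention if the restriction is not differentiable at `y`. -/
def gradientAlong {d : ℕ} (T : Submodule ℝ (Euc d)) (f : Euc d → ℝ) (y : Euc d) : T :=
  gradient (fun v : T => f (y + (v : Euc d))) 0

/-- The tangential gradient `∇^M f(y)`: the gradient at `y` of the restriction of `f` to the affine
subspace `y + T_y M`. For a locally Lipschitz `f` and a rectifiable `M` of locally finite `ℋⁿ`
measure it exists for `ℋⁿ`-almost every `y ∈ M`; elsewhere the value is `0` by convention. -/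
def tangentialGradient (n : ℕ) (M : Set (Euc (n + 1))) (f : Euc (n + 1) → ℝ) (y : Euc (n + 1)) :
    Euc (n + 1) :=
  (gradientAlong (approxTangentSpace n M y) f y : Euc (n + 1))

/-- The Poincaré-type inequality with constant `C`: for all `x ∈ M`, `r > 0` and all locally
Lipschitz `f` on `ℝ^{n+1}`,
`⨍_{B_r(x)} |f - f_{x,r}| dμ ≤ C r (⨍_{B_{2r}(x)} |∇^M f|² dμ)^{1/2}`. -/
def SatisfiesPoincare (n : ℕ) (C : ℝ) (M : Set (Euc (n + 1))) : Prop :=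
  ∀ x ∈ M, ∀ r : ℝ, 0 < r → ∀ f : Euc (n + 1) → ℝ, LocallyLipschitz f →
    ⨍ y in Metric.ball x r, |f y - ⨍ z in Metric.ball x r, f z ∂surfaceMeasure n M|
        ∂surfaceMeasure n M
      ≤ C * r * Real.sqrt
        (⨍ y in Metric.ball x (2 * r), ‖tangentialGradient n M f y‖ ^ 2 ∂surfaceMeasure n M)

/-- A metric space `X` is `κ`-quasiconvex: `κ ≥ 1` and any two points `x`, `y` are joined by a
rectifiable curve in `X` of length at most `κ d(x, y)`. -/
def IsQuasiconvexSpace (κ : ℝ) (X : Type*) [MetricSpace X] : Prop :=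
  1 ≤ κ ∧ ∀ x y : X, ∃ γ : Path x y,
    eVariationOn (γ : unitInterval → X) Set.univ ≤ ENNReal.ofReal (κ * dist x y)

end

/-! Fix `x` and let `f` be the length of the shortest chain from `x` in `M` with steps shorter than
`ε`, truncated at a height `N`. At scales below `ε`, `f` is 1-Lipschitz along `M`. Tangent
directions are limits of secants of `M`, so `|∇^M f| ≤ 1` on `M` however small `ε` is. The Poincaré
inequality and doubling, telescoped over dyadic balls, turn this into `|f x - f y| ≤ 8 D |C_P| d(x,
y)`, a bound free of `ε` (`abs_sub_le_of_norm_tangentialGradient_le_one`).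

With `N` slightly above this bound the truncation is inactive at `y`, so `x` and `y` are joined by
`ε`-chains of length at most `N` for every `ε`. Compactness of `M` then yields a curve in the limit
`ε → 0` (`IsCompact.exists_path_of_forall_chain`). -/

/-- The approximate tangent space consists of limits of secant directions of `M`. -/
theorem IsApproxTangentSpace.eventually_exists_mem {n : ℕ} {M : Set (Euc (n + 1))}
    {x : Euc (n + 1)} {P : Submodule ℝ (Euc (n + 1))} (hP : IsApproxTangentSpace n M x P)
    {v : Euc (n + 1)} (hv : v ∈ P) {δ : ℝ} (hδ : 0 < δ) :
    ∀ᶠ t : ℝ in 𝓝[>] 0, ∃ y ∈ M, dist y (x + t • v) < t * δ := by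
  -- Were `M` to miss the ball of radius `t * δ` about `x + t • v`, the rescaled integral of this
  -- bump would vanish, whereas its limit is positive.
  let φ : ContDiffBump v := ⟨δ / 2, δ, by positivity, by linarith⟩
  have hpos : 0 < ∫ y in (P : Set (Euc (n + 1))), φ y ∂μHE[n] := by
    have hiso : Isometry (Subtype.val : P → Euc (n + 1)) := isometry_subtype_coe
    have hmap := hiso.map_euclideanHausdorffMeasure (d := n)
    rw [Subtype.range_coe_subtype] at hmap
    have hemb : MeasurableEmbedding (Subtype.val : P → Euc (n + 1)) :=
      hiso.isClosedEmbedding.measurableEmbedding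
    have hset : {y | y ∈ P} = (P : Set (Euc (n + 1))) := rfl
    rw [← hset, ← hmap, hemb.integral_map]
    have hH : (μHE[n] : Measure P).IsAddHaarMeasure := by
      have := isAddHaarMeasure_euclideanHausdorffMeasure (E := P)
      rwa [hP.1] at this
    refine Continuous.integral_pos_of_hasCompactSupport_nonneg_nonzero (x := ⟨v, hv⟩)
      (φ.continuous.comp continuous_subtype_val)
      (φ.hasCompactSupport.comp_isClosedEmbedding hiso.isClosedEmbedding)
      (fun y => φ.nonneg) ?_
    have : φ v = 1 := φ.eventuallyEq_one.eq_of_nhds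
    simp [this]
  filter_upwards [(hP.2 φ φ.contDiff φ.hasCompactSupport).eventually_const_lt hpos,
    self_mem_nhdsWithin] with t ht (ht0 : 0 < t)
  by_contra! hcon
  refine ht.ne' ?_
  rw [setIntegral_eq_zero_of_forall_eq_zero, mul_zero]
  intro y hy
  have hd := hcon y hy
  refine φ.zero_of_le_dist ?_
  have heq : t⁻¹ • (y - x) - v = t⁻¹ • (y - (x + t • v)) := by
    rw [← sub_sub, smul_sub t⁻¹ (y - x), inv_smul_smul₀ ht0.ne']
  rw [dist_eq_norm, heq, norm_smul, norm_inv, Real.norm_of_nonneg ht0.le, ← dist_eq_norm]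
  change δ ≤ _
  rwa [inv_mul_eq_div, le_div_iff₀' ht0]

/-- If `f` is `1`-Lipschitz at small scales along `M`, then `|∇^M f| ≤ 1` on `M`. -/
theorem norm_tangentialGradient_le_one {n : ℕ} {M : Set (Euc (n + 1))}
    {f : Euc (n + 1) → ℝ} {K : NNReal} (hf : LipschitzWith K f) {ε : ℝ} (hε : 0 < ε)
    (hloc : ∀ y ∈ M, ∀ z ∈ M, dist y z < ε → |f y - f z| ≤ dist y z)
    {y : Euc (n + 1)} (hy : y ∈ M) : ‖tangentialGradient n M f y‖ ≤ 1 := by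
  by_cases h : ∃ P, IsApproxTangentSpace n M y P
  swap
  · have hT : approxTangentSpace n M y = ⊥ := dif_neg h
    have := (gradientAlong (approxTangentSpace n M y) f y).2
    rw [hT, Submodule.mem_bot] at this
    rw [tangentialGradient, hT, this]
    simp
  have hT : IsApproxTangentSpace n M y (approxTangentSpace n M y) := by
    rw [approxTangentSpace, dif_pos h]; exact h.choose_spec
  rw [tangentialGradient]
  set P := approxTangentSpace n M y with hPdef
  set F : P → ℝ := fun v : P => f (y + (v : Euc (n + 1))) with hF
  set g : P := gradientAlong P f y with hg
  rw [Submodule.norm_coe]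
  by_cases hdiff : DifferentiableAt ℝ F 0
  swap
  · have : g = 0 := gradient_eq_zero_of_not_differentiableAt hdiff
    simp [this]
  have hgrad : HasGradientAt F g 0 := hdiff.hasGradientAt
  have hline : HasDerivAt (fun t : ℝ => F (t • g)) (‖g‖ ^ 2) 0 := by
    have h1 : HasFDerivAt F (InnerProductSpace.toDual ℝ P g) ((0 : ℝ) • g) := by
      rw [zero_smul]; exact hgrad.hasFDerivAt
    have h2 : HasDerivAt (fun t : ℝ => t • g) g 0 := by
      simpa using (hasDerivAt_id (0 : ℝ)).smul_const g
    have := h1.comp_hasDerivAt (0 : ℝ) h2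
    rwa [InnerProductSpace.toDual_apply_apply, real_inner_self_eq_norm_sq] at this
  have hslope := hline.tendsto_slope_zero_right
  -- Replace `y + t • g` by a point `z` of `M` within `t * δ`. This costs `K * t * δ` by the global
  -- Lipschitz bound, and the 1-Lipschitz bound along `M` gives `t * (‖g‖ + δ)` for the rest.
  have key : ∀ δ : ℝ, 0 < δ → ‖g‖ ^ 2 ≤ ‖g‖ + (1 + K) * δ := by
    intro δ hδ
    refine le_of_tendsto hslope ?_
    have hsmall : ∀ᶠ t : ℝ in 𝓝[>] 0, t * (‖g‖ + δ) < ε := by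
      have : Tendsto (fun t : ℝ => t * (‖g‖ + δ)) (𝓝[>] 0) (𝓝 (0 * (‖g‖ + δ))) :=
        ((continuous_id.mul continuous_const).tendsto 0).mono_left nhdsWithin_le_nhds
      rw [zero_mul] at this
      exact this.eventually_lt_const hε
    filter_upwards [hT.eventually_exists_mem g.2 hδ, hsmall, self_mem_nhdsWithin]
      with t ⟨z, hz, hzd⟩ hts (ht : 0 < t)
    have hn : dist (y + t • (g : Euc (n + 1))) y = t * ‖g‖ := by
      rw [dist_eq_norm, add_sub_cancel_left, norm_smul, Real.norm_of_nonneg ht.le,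
        Submodule.norm_coe]
    have hzy : dist z y < t * (‖g‖ + δ) := by
      have := dist_triangle z (y + t • (g : Euc (n + 1))) y
      nlinarith
    have h1 := (abs_le.1 (hloc z hz y hy (hzy.trans hts))).2
    have h2 : f (y + t • (g : Euc (n + 1))) - f z ≤ K * (t * δ) := by
      have := hf.dist_le_mul (y + t • (g : Euc (n + 1))) z
      rw [Real.dist_eq, dist_comm] at this
      exact (le_abs_self _).trans (this.trans (by gcongr))
    have h3 : F ((0 + t) • g) - F ((0 : ℝ) • g) = f (y + t • (g : Euc (n + 1))) - f y := by
      simp [hF]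
    rw [h3, smul_eq_mul, inv_mul_le_iff₀ ht]
    nlinarith
  have hlim : ‖g‖ ^ 2 ≤ ‖g‖ := by
    refine le_of_forall_pos_le_add fun η hη => ?_
    have hK : (0 : ℝ) < 1 + K := by positivity
    have := key (η / (1 + K)) (by positivity)
    rwa [mul_div_cancel₀ _ hK.ne'] at this
  nlinarith [norm_nonneg g]

/-! ### Chains and their limit curves -/

/-- `IsChainOfLength M ε x y ℓ`: the points `x` and `y` are the ends of a chain in `M` with steps
shorter than `ε` and total length `ℓ`. -/
inductive IsChainOfLength {X : Type*} [PseudoMetricSpace X] (M : Set X) (ε : ℝ) (x : X) :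
    X → ℝ → Prop
  | refl : IsChainOfLength M ε x x 0
  | step {y z : X} {l : ℝ} : IsChainOfLength M ε x y l → z ∈ M → dist y z < ε →
      IsChainOfLength M ε x z (l + dist y z)

namespace IsChainOfLength

variable {X : Type*} [MetricSpace X] {M : Set X} {ε : ℝ} {x y : X} {l : ℝ}

theorem nonneg (h : IsChainOfLength M ε x y l) : 0 ≤ l := by
  induction h with
  | refl => exact le_rfl
  | step _ _ _ ih => positivity

/-- A chain, parametrized by arc length as a step function. -/
theorem exists_stepFunction (h : IsChainOfLength M ε x y l) (hε : 0 < ε) (hx : x ∈ M) :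
    ∃ g : ℝ → X, (∀ t, g t ∈ M) ∧ g 0 = x ∧ (∀ t, l ≤ t → g t = y) ∧
      ∀ s t, dist (g s) (g t) ≤ |s - t| + ε := by
  induction h with
  | refl => exact ⟨fun _ => x, fun _ => hx, rfl, fun _ _ => rfl, fun s t => by
      rw [dist_self]; positivity⟩
  | @step y z l hc hz hd ih =>
    obtain ⟨g, hgM, hg0, hgl, hg⟩ := ih
    have hl := hc.nonneg
    have hlt : ∀ s t, s < l + dist y z → l + dist y z ≤ t → dist (g s) z ≤ |s - t| + ε := by
      intro s t hs ht
      rcases le_total l s with h | h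
      · rw [hgl s h]
        linarith [abs_nonneg (s - t)]
      · have h1 := hg s l
        rw [hgl l le_rfl, abs_sub_comm, abs_of_nonneg (sub_nonneg.2 h)] at h1
        have h2 := dist_triangle (g s) y z
        rw [abs_sub_comm, abs_of_nonneg (by linarith)]
        linarith
    -- The new function waits at `y` from time `l` and jumps to `z` at time `l + dist y z`; the
    -- additive `ε` absorbs the jump.
    refine ⟨fun t => if t < l + dist y z then g t else z, fun t => ?_, ?_, fun t ht => ?_,
      fun s t => ?_⟩
    · dsimp only
      split_ifs
      exacts [hgM t, hz]
    · dsimp only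
      split_ifs with h
      · exact hg0
      · have h1 : dist y z = 0 := le_antisymm (by linarith) dist_nonneg
        rw [← dist_eq_zero.1 h1, ← hg0, hgl 0 (by linarith)]
    · exact if_neg (not_lt.2 ht)
    · dsimp only
      split_ifs with h1 h2 h2
      · exact hg s t
      · exact hlt s t h1 (not_lt.1 h2)
      · rw [dist_comm, abs_sub_comm]
        exact hlt t s h2 (not_lt.1 h1)
      · rw [dist_self]; positivity

end IsChainOfLength

/-- In a compact set, two points which are joined by arbitrarily fine chains of length at most `L`
are joined by an `L`-Lipschitz curve on the unit interval. -/
theorem IsCompact.exists_path_of_forall_chain {X : Type*} [MetricSpace X] {M : Set X}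
    (hM : IsCompact M) (x y : M) {L : ℝ}
    (h : ∀ ε > 0, ∃ l ≤ L, IsChainOfLength M ε (x : X) y l) :
    ∃ γ : Path x y, eVariationOn (γ : unitInterval → M) Set.univ ≤ ENNReal.ofReal L := by
  have hL : 0 ≤ L := by
    obtain ⟨l, hl, hc⟩ := h 1 one_pos
    exact hc.nonneg.trans hl
  have hstep : ∀ k : ℕ, ∃ g : ℝ → X, (∀ t, g t ∈ M) ∧ g 0 = x ∧ g 1 = y ∧
      ∀ s t, dist (g s) (g t) ≤ L * |s - t| + 1 / ((k : ℝ) + 1) := by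
    intro k
    obtain ⟨l, hl, hc⟩ := h (1 / ((k : ℝ) + 1)) (by positivity)
    obtain ⟨g, hgM, hg0, hgl, hg⟩ := hc.exists_stepFunction (by positivity) x.2
    refine ⟨fun t => g (L * t), fun t => hgM _, by simpa using hg0, hgl _ (by simpa using hl),
      fun s t => (hg _ _).trans_eq ?_⟩
    rw [← mul_sub, abs_mul, abs_of_nonneg hL]
  choose g hgM hg0 hg1 hg using hstep
  -- A single ultrafilter gives limits at all times at once, so no subsequence depending on `t` is
  -- needed.
  have hlim : ∀ t : ℝ, ∃ a ∈ M, Tendsto (fun k => g k t) (hyperfilter ℕ) (𝓝 a) := fun t =>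
    hM.ultrafilter_le_nhds' ((hyperfilter ℕ).map fun k => g k t)
      (Ultrafilter.mem_map.2 (Filter.univ_mem' fun k => hgM k t))
  choose G hGM hG using hlim
  have hG0 : G 0 = x := tendsto_nhds_unique (hG 0) (by simp [hg0])
  have hG1 : G 1 = y := tendsto_nhds_unique (hG 1) (by simp [hg1])
  have hGL : ∀ s t, dist (G s) (G t) ≤ L * |s - t| := by
    intro s t
    have h1 : Tendsto (fun k : ℕ => L * |s - t| + 1 / ((k : ℝ) + 1)) (hyperfilter ℕ)
        (𝓝 (L * |s - t| + 0)) :=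
      (tendsto_const_nhds.add tendsto_one_div_add_atTop_nhds_zero_nat).mono_left
        Nat.hyperfilter_le_atTop
    rw [add_zero] at h1
    exact le_of_tendsto_of_tendsto' ((hG s).dist (hG t)) h1 fun k => hg k s t
  let γ₀ : unitInterval → M := fun t => ⟨G t, hGM t⟩
  have hγ : LipschitzWith L.toNNReal γ₀ := LipschitzWith.of_dist_le_mul fun s t => by
    rw [Real.coe_toNNReal _ hL]
    exact hGL s t
  refine ⟨⟨⟨γ₀, hγ.continuous⟩, Subtype.ext (by simpa [γ₀] using hG0),
    Subtype.ext (by simpa [γ₀] using hG1)⟩, ?_⟩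
  change eVariationOn (γ₀ ∘ id) Set.univ ≤ _
  refine ((hγ.lipschitzOnWith (s := Set.univ)).comp_eVariationOn_le
    (Set.mapsTo_univ _ _)).trans ?_
  have hid : eVariationOn (id : unitInterval → unitInterval) Set.univ ≤ 1 := by
    have hmono : MonotoneOn (fun t : unitInterval => (t : ℝ)) Set.univ := fun _ _ _ _ h => h
    have h2 := (hmono.eVariationOn_eq (Set.mem_univ 0) (Set.mem_univ 1)).le
    have huniv : (Set.Icc 0 1 : Set unitInterval) = Set.univ :=
      Set.eq_univ_of_forall fun t => ⟨unitInterval.nonneg', unitInterval.le_one'⟩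
    rw [huniv, Set.univ_inter, Set.Icc.coe_one, Set.Icc.coe_zero, sub_zero,
      ENNReal.ofReal_one] at h2
    exact h2
  calc _ ≤ (L.toNNReal : ENNReal) * 1 := by gcongr
    _ = ENNReal.ofReal L := by rw [mul_one]; rfl

/-! ### Covering and doubling -/

/-- Every subset of the unit ball is covered by boundedly many balls of radius `s` centred at its own points. -/
theorem exists_card_cover_ball (d : ℕ) {s : ℝ} (hs : 0 < s) :
    ∃ N : ℕ, ∀ M : Set (Euc d), M ⊆ Metric.ball 0 1 →
      ∃ T : Finset (Euc d), T.card ≤ N ∧ ↑T ⊆ M ∧ M ⊆ ⋃ x ∈ T, Metric.ball x s := by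
  classical
  have htb : TotallyBounded (Metric.ball (0 : Euc d) 1) :=
    (isCompact_closedBall (0 : Euc d) 1).totallyBounded.subset Metric.ball_subset_closedBall
  -- Radius `s / 2` leaves room to move each centre to a point of `M` in its ball.
  obtain ⟨t, ht, hcov⟩ := Metric.totallyBounded_iff.1 htb (s / 2) (by positivity)
  lift t to Finset (Euc d) using ht
  refine ⟨t.card, fun M hM => ?_⟩
  have hchoice : ∀ c : Euc d, ∃ x : Euc d,
      (M ∩ Metric.ball c (s / 2)).Nonempty → x ∈ M ∩ Metric.ball c (s / 2) := fun c => by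
    by_cases h : (M ∩ Metric.ball c (s / 2)).Nonempty
    · exact ⟨h.some, fun _ => h.some_mem⟩
    · exact ⟨0, fun h' => absurd h' h⟩
  choose p hp using hchoice
  refine ⟨(t.filter fun c => (M ∩ Metric.ball c (s / 2)).Nonempty).image p,
    Finset.card_image_le.trans (Finset.card_filter_le _ _), ?_, fun y hy => ?_⟩
  · intro x hx
    obtain ⟨c, hc, rfl⟩ := Finset.mem_image.1 (Finset.mem_coe.1 hx)
    exact (hp c (Finset.mem_filter.1 hc).2).1
  · obtain ⟨c, hc, hyc⟩ := Set.mem_iUnion₂.1 (hcov (hM hy))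
    have hne : (M ∩ Metric.ball c (s / 2)).Nonempty := ⟨y, hy, hyc⟩
    refine Set.mem_iUnion₂.2 ⟨p c, Finset.mem_image_of_mem p (Finset.mem_filter.2 ⟨hc, hne⟩), ?_⟩
    have h1 := Metric.mem_ball.1 (hp c hne).2
    have h2 := Metric.mem_ball.1 hyc
    have h3 := dist_triangle_right y (p c) c
    exact Metric.mem_ball.2 (by linarith)

/-- Bounded Ahlfors regular sets have a doubling surface measure, uniformly over all scales. -/
theorem exists_doubling_constant (n : ℕ) (C : ℝ) :
    ∃ D : ℝ, ∀ M : Set (Euc (n + 1)), M ⊆ Metric.ball 0 1 → IsAhlforsRegularSet n C M →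
      IsFiniteMeasure (surfaceMeasure n M) ∧ 0 ≤ D ∧
      ∀ x ∈ M, ∀ y ∈ M, ∀ r : ℝ, 0 < r →
        0 < (surfaceMeasure n M).real (Metric.ball y r) ∧
        (surfaceMeasure n M).real (Metric.ball x (2 * r))
          ≤ D * (surfaceMeasure n M).real (Metric.ball y r) := by
  obtain ⟨N, hN⟩ := exists_card_cover_ball (n + 1) (s := 1 / 2) (by norm_num)
  -- For `r < 1/2` regularity at radii `r` and `2 * r` gives `C ^ 2 * 2 ^ n`. For larger `r` the
  -- total mass, at most `N * C`, is compared with a ball of radius `1/2`. The factor `N + 1` covers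
  -- both cases.
  refine ⟨(N + 1) * C ^ 2 * 2 ^ n, fun M hM hC => ?_⟩
  set μ := surfaceMeasure n M with hμ
  have hC1 := hC.one_le
  have hC0 : 0 < C := by linarith
  have hmass : μ Set.univ ≤ ENNReal.ofReal (N * C) := by
    obtain ⟨T, hTN, hTM, hcov⟩ := hN M hM
    have h1 : μ Set.univ = μ M := by
      rw [hμ, surfaceMeasure, Measure.restrict_apply_univ, Measure.restrict_apply_self]
    calc μ Set.univ ≤ μ (⋃ x ∈ T, Metric.ball x (1 / 2)) := h1.trans_le (measure_mono hcov)
      _ ≤ ∑ x ∈ T, μ (Metric.ball x (1 / 2)) := measure_biUnion_finset_le _ _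
      _ ≤ ∑ x ∈ T, ENNReal.ofReal C := Finset.sum_le_sum fun x hx =>
          (hC.upper x (hTM hx) (1 / 2) (by norm_num) (by norm_num)).trans
            (ENNReal.ofReal_le_ofReal (mul_le_of_le_one_right hC0.le
              (pow_le_one₀ (by norm_num) (by norm_num))))
      _ = ENNReal.ofReal (T.card * C) := by
          rw [Finset.sum_const, nsmul_eq_mul, ENNReal.ofReal_mul (by positivity),
            ENNReal.ofReal_natCast]
      _ ≤ ENNReal.ofReal (N * C) := by gcongr
  have hfin : IsFiniteMeasure μ := ⟨hmass.trans_lt ENNReal.ofReal_lt_top⟩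
  have hlow : ∀ y ∈ M, ∀ r : ℝ, 0 < r → r < 1 → C⁻¹ * r ^ n ≤ μ.real (Metric.ball y r) :=
    fun y hy r h0 h1 => (ENNReal.ofReal_le_iff_le_toReal (measure_ne_top _ _)).1
      (hC.lower y hy r h0 h1)
  refine ⟨hfin, by positivity, fun x hx y hy r hr => ?_⟩
  rcases lt_or_ge r (1 / 2) with h | h
  · have h1 := hlow y hy r hr (by linarith)
    have h2 : μ.real (Metric.ball x (2 * r)) ≤ C * (2 * r) ^ n :=
      ENNReal.toReal_le_of_le_ofReal (by positivity)
        (hC.upper x hx (2 * r) (by positivity) (by linarith))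
    refine ⟨lt_of_lt_of_le (by positivity) h1, h2.trans ?_⟩
    calc C * (2 * r) ^ n = 1 * C ^ 2 * 2 ^ n * (C⁻¹ * r ^ n) := by
          rw [mul_pow]; field_simp
      _ ≤ (N + 1) * C ^ 2 * 2 ^ n * μ.real (Metric.ball y r) := by
          gcongr
          simp
  · have h1 : C⁻¹ * (1 / 2) ^ n ≤ μ.real (Metric.ball y r) :=
      (hlow y hy (1 / 2) (by norm_num) (by norm_num)).trans
        (measureReal_mono (Metric.ball_subset_ball h))
    have h2 : μ.real (Metric.ball x (2 * r)) ≤ N * C :=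
      ENNReal.toReal_le_of_le_ofReal (by positivity)
        ((measure_mono (Set.subset_univ _)).trans hmass)
    refine ⟨lt_of_lt_of_le (by positivity) h1, h2.trans ?_⟩
    calc N * C = N * C ^ 2 * 2 ^ n * (C⁻¹ * (1 / 2) ^ n) := by
          rw [div_pow, one_pow]; field_simp
      _ ≤ (N + 1) * C ^ 2 * 2 ^ n * μ.real (Metric.ball y r) := by
          gcongr
          linarith

/-! ### From a gradient bound to a Lipschitz bound -/

section Oscillation

variable {n : ℕ} {C D : ℝ} {M : Set (Euc (n + 1))} {f : Euc (n + 1) → ℝ} {K : NNReal}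

theorem integrable_of_lipschitzWith [IsFiniteMeasure (surfaceMeasure n M)]
    (hM : M ⊆ Metric.ball 0 1) (hMc : IsClosed M) (hf : LipschitzWith K f) :
    Integrable f (surfaceMeasure n M) := by
  refine Integrable.of_bound hf.continuous.aestronglyMeasurable (|f 0| + K) ?_
  refine (ae_restrict_iff' hMc.measurableSet).2 (Eventually.of_forall fun y hy => ?_)
  have h1 := hf.dist_le_mul y 0
  have h2 : dist y 0 ≤ 1 := (Metric.mem_ball.1 (hM hy)).le
  rw [Real.dist_eq] at h1
  rw [Real.norm_eq_abs]
  have h3 := abs_sub_abs_le_abs_sub (f y) (f 0)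
  nlinarith [K.2]

theorem setAverage_abs_sub_le_of_norm_tangentialGradient_le_one
    (hP : SatisfiesPoincare n C M) (hMc : IsClosed M)
    [IsFiniteMeasure (surfaceMeasure n M)] (hf : LipschitzWith K f)
    (hgrad : ∀ y ∈ M, ‖tangentialGradient n M f y‖ ≤ 1) {x : Euc (n + 1)} (hx : x ∈ M) {r : ℝ}
    (hr : 0 < r) :
    ⨍ y in Metric.ball x r, |f y - ⨍ z in Metric.ball x r, f z ∂surfaceMeasure n M|
        ∂surfaceMeasure n M ≤ |C| * r := by
  refine (hP x hx r hr f hf.locallyLipschitz).trans ?_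
  have hae : ∀ᵐ y ∂(surfaceMeasure n M).restrict (Metric.ball x (2 * r)),
      ‖tangentialGradient n M f y‖ ^ 2 ≤ 1 := by
    refine ae_restrict_of_ae ((ae_restrict_iff' hMc.measurableSet).2
      (Eventually.of_forall fun y hy => ?_))
    exact pow_le_one₀ (norm_nonneg _) (hgrad y hy)
  have h1 : ⨍ y in Metric.ball x (2 * r), ‖tangentialGradient n M f y‖ ^ 2 ∂surfaceMeasure n M
      ≤ 1 := by
    rw [setAverage_eq, smul_eq_mul]
    have h2 : ∫ y in Metric.ball x (2 * r), ‖tangentialGradient n M f y‖ ^ 2 ∂surfaceMeasure n M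
        ≤ (surfaceMeasure n M).real (Metric.ball x (2 * r)) := by
      refine (integral_mono_of_nonneg (Eventually.of_forall fun y => by positivity)
        (integrable_const (1 : ℝ)) hae).trans_eq ?_
      simp
    exact inv_mul_le_one_of_le₀ h2 measureReal_nonneg
  calc C * r * Real.sqrt _ ≤ |C| * r * 1 := by
        gcongr
        · exact le_abs_self C
        · exact Real.sqrt_le_one.2 h1
    _ = |C| * r := mul_one _

/-- Enlarging the domain of integration of `|f - c|` from `s` to `t` costs only the ratio of
measures; this compares averages over nested balls. -/
theorem abs_setAverage_sub_le {α : Type*} [MeasurableSpace α] {μ : Measure α} {f : α → ℝ}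
    {s t : Set α} (hst : s ⊆ t) (hs : 0 < μ.real s) (hD : μ.real t ≤ D * μ.real s)
    (hft : IntegrableOn f t μ) (ht : μ t ≠ ⊤) (c : ℝ) :
    |(⨍ y in s, f y ∂μ) - c| ≤ D * ⨍ y in t, |f y - c| ∂μ := by
  have htpos : 0 < μ.real t := hs.trans_le (measureReal_mono hst ht)
  have hst' : μ s ≠ ⊤ := measure_ne_top_of_subset hst ht
  have hconst : ∀ u : Set α, μ u ≠ ⊤ → IntegrableOn (fun _ => c) u μ := fun u hu =>
    integrableOn_const hu
  have h1 : (⨍ y in s, f y ∂μ) - c = (μ.real s)⁻¹ * ∫ y in s, (f y - c) ∂μ := by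
    rw [integral_sub (hft.mono_set hst) (hconst s hst'), setIntegral_const, setAverage_eq,
      smul_eq_mul, smul_eq_mul]
    field_simp
  rw [h1, abs_mul, abs_of_pos (inv_pos.2 hs), setAverage_eq, smul_eq_mul]
  have hint : IntegrableOn (fun y => |f y - c|) t μ := (hft.sub (hconst t ht)).abs
  have h2 : |∫ y in s, (f y - c) ∂μ| ≤ ∫ y in t, |f y - c| ∂μ :=
    (abs_integral_le_integral_abs).trans (setIntegral_mono_set hint
      (Eventually.of_forall fun _ => abs_nonneg _) hst.eventuallyLE)
  have h3 : 0 ≤ ∫ y in t, |f y - c| ∂μ := integral_nonneg fun _ => abs_nonneg _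
  rw [← mul_assoc]
  have h4 : (μ.real s)⁻¹ ≤ D * (μ.real t)⁻¹ := by
    rw [← div_eq_mul_inv, le_div_iff₀ htpos, inv_mul_le_iff₀ hs, mul_comm]
    exact hD
  exact mul_le_mul h4 h2 (abs_nonneg _) ((inv_pos.2 hs).le.trans h4)

/-- Under a Poincaré inequality, functions with tangential gradient bounded by `1` are Lipschitz
on `M`, with a quantitative constant. -/
theorem abs_sub_le_of_norm_tangentialGradient_le_one
    (hM : M ⊆ Metric.ball 0 1) (hMc : IsClosed M) (hP : SatisfiesPoincare n C M)
    [IsFiniteMeasure (surfaceMeasure n M)] (hD0 : 0 ≤ D)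
    (hD : ∀ x ∈ M, ∀ y ∈ M, ∀ r : ℝ, 0 < r →
        0 < (surfaceMeasure n M).real (Metric.ball y r) ∧
        (surfaceMeasure n M).real (Metric.ball x (2 * r))
          ≤ D * (surfaceMeasure n M).real (Metric.ball y r))
    (hf : LipschitzWith K f) (hgrad : ∀ y ∈ M, ‖tangentialGradient n M f y‖ ≤ 1)
    {x y : Euc (n + 1)} (hx : x ∈ M) (hy : y ∈ M) :
    |f x - f y| ≤ 8 * (D * |C|) * dist x y := by
  rcases eq_or_ne x y with rfl | hxy
  · simp
  set μ := surfaceMeasure n M with hμ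
  have hint : Integrable f μ := integrable_of_lipschitzWith hM hMc hf
  have hcompare : ∀ u ∈ M, ∀ v ∈ M, ∀ r : ℝ, 0 < r →
      Metric.ball v r ⊆ Metric.ball u (2 * r) →
      dist (⨍ z in Metric.ball v r, f z ∂μ) (⨍ z in Metric.ball u (2 * r), f z ∂μ)
        ≤ 2 * (D * |C|) * r := by
    intro u hu v hv r hr hsub
    obtain ⟨h1, h2⟩ := hD u hu v hv r hr
    rw [Real.dist_eq]
    refine (abs_setAverage_sub_le hsub h1 h2 hint.integrableOn (measure_ne_top _ _) _).trans ?_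
    refine (mul_le_mul_of_nonneg_left (setAverage_abs_sub_le_of_norm_tangentialGradient_le_one
      hP hMc hf hgrad hu (by positivity : 0 < 2 * r)) hD0).trans_eq ?_
    ring
  have hpoint : ∀ u ∈ M, ∀ r : ℝ, 0 < r →
      dist (⨍ z in Metric.ball u r, f z ∂μ) (f u) ≤ 2 * (D * |C|) * r := by
    intro u hu r hr
    -- The constant `K` serves only to show that averages over shrinking balls converge to `f u`; it
    -- does not enter the final bound.
    have hlim : Tendsto (fun k : ℕ => ⨍ z in Metric.ball u (r / 2 ^ k), f z ∂μ) atTop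
        (𝓝 (f u)) := by
      rw [tendsto_iff_dist_tendsto_zero]
      have hz : Tendsto (fun k : ℕ => K * (r / 2 ^ k)) atTop (𝓝 0) := by
        have := (tendsto_pow_atTop_nhds_zero_of_lt_one (r := (1 / 2 : ℝ)) (by norm_num)
          (by norm_num)).const_mul (K * r)
        rw [mul_zero] at this
        refine this.congr fun k => ?_
        rw [div_pow, one_pow]; ring
      refine squeeze_zero (fun _ => dist_nonneg) (fun k => ?_) hz
      have hrk : 0 < r / 2 ^ k := by positivity
      have h1 := (hD u hu u hu _ hrk).1
      rw [Real.dist_eq]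
      refine (abs_setAverage_sub_le (D := 1) subset_rfl h1 (by rw [one_mul]) hint.integrableOn
        (measure_ne_top _ _) _).trans ?_
      rw [one_mul, setAverage_eq, smul_eq_mul, inv_mul_le_iff₀ h1]
      refine (Real.le_norm_self _).trans
        ((norm_setIntegral_le_of_norm_le_const (measure_lt_top _ _) (C := K * (r / 2 ^ k))
          fun z hz => ?_).trans_eq (mul_comm _ _))
      rw [norm_abs_eq_norm, ← dist_eq_norm]
      exact (hf.dist_le_mul z u).trans (by gcongr; exact (Metric.mem_ball.1 hz).le)
    have hgeo : ∀ k : ℕ, dist (⨍ z in Metric.ball u (r / 2 ^ k), f z ∂μ)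
        (⨍ z in Metric.ball u (r / 2 ^ (k + 1)), f z ∂μ) ≤ 2 * (D * |C|) * r / 2 / 2 ^ k := by
      intro k
      have hrk : 0 < r / 2 ^ (k + 1) := by positivity
      have h2 : 2 * (r / 2 ^ (k + 1)) = r / 2 ^ k := by rw [pow_succ]; field_simp
      have := hcompare u hu u hu _ hrk (Metric.ball_subset_ball (by linarith))
      rw [h2] at this
      rw [dist_comm]
      refine this.trans_eq ?_
      rw [pow_succ]; field_simp
    simpa using dist_le_of_le_geometric_two_of_tendsto₀ hgeo hlim
  have hr : 0 < dist x y := dist_pos.2 hxy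
  have hsub : Metric.ball y (dist x y) ⊆ Metric.ball x (2 * dist x y) :=
    Metric.ball_subset_ball' (by rw [dist_comm y x]; linarith)
  have h1 := hpoint x hx (2 * dist x y) (by positivity)
  -- The factor 8 is 4 + 2 + 2: from `f x` to its average at radius `2 * dist x y`, across to the
  -- average about `y`, and from there to `f y`.
  have h2 := hcompare x hx y hy _ hr hsub
  have h3 := hpoint y hy _ hr
  rw [← Real.dist_eq]
  rw [dist_comm] at h1 h2
  have h4 := dist_triangle4 (f x) (⨍ z in Metric.ball x (2 * dist x y), f z ∂μ)
    (⨍ z in Metric.ball y (dist x y), f z ∂μ) (f y)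
  linarith

end Oscillation

/-! ### Truncated chain distance -/

/-- The distance along chains with steps shorter than `ε`, truncated at height `N`. -/
noncomputable def chainDist {X : Type*} [PseudoMetricSpace X] (M : Set X) (ε : ℝ) (x : X) (N : ℝ) (y : X) : ℝ :=
  sInf (insert N {l | IsChainOfLength M ε x y l})

section ChainDist

variable {X : Type*} [MetricSpace X] {M : Set X} {ε N : ℝ} {x y z : X}

theorem zero_mem_lowerBounds_chainLengths (hN : 0 ≤ N) :
    (0 : ℝ) ∈ lowerBounds (insert N {l | IsChainOfLength M ε x y l}) := by
  rintro l (rfl | h)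
  exacts [hN, IsChainOfLength.nonneg h]

theorem chainDist_nonneg (hN : 0 ≤ N) : 0 ≤ chainDist M ε x N y :=
  le_csInf (Set.insert_nonempty _ _) fun _ h => zero_mem_lowerBounds_chainLengths hN h

theorem chainDist_le (hN : 0 ≤ N) : chainDist M ε x N y ≤ N :=
  csInf_le ⟨0, zero_mem_lowerBounds_chainLengths hN⟩ (Set.mem_insert _ _)

theorem chainDist_self (hN : 0 ≤ N) : chainDist M ε x N x = 0 :=
  le_antisymm (csInf_le ⟨0, zero_mem_lowerBounds_chainLengths hN⟩
    (Or.inr IsChainOfLength.refl)) (chainDist_nonneg hN)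

theorem chainDist_le_add (hN : 0 ≤ N) (hz : z ∈ M) (h : dist y z < ε) :
    chainDist M ε x N z ≤ chainDist M ε x N y + dist y z := by
  rw [← sub_le_iff_le_add]
  refine le_csInf (Set.insert_nonempty _ _) ?_
  rintro l (rfl | hl)
  · linarith [chainDist_le (M := M) (ε := ε) (x := x) (y := z) hN, dist_nonneg (x := y) (y := z)]
  · rw [sub_le_iff_le_add]
    exact csInf_le ⟨0, zero_mem_lowerBounds_chainLengths hN⟩
      (Or.inr (IsChainOfLength.step hl hz h))

theorem abs_chainDist_sub_le (hN : 0 ≤ N) (hy : y ∈ M) (hz : z ∈ M) (h : dist y z < ε) :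
    |chainDist M ε x N y - chainDist M ε x N z| ≤ dist y z := by
  have h1 := chainDist_le_add (x := x) hN hz h
  have h2 := chainDist_le_add (x := x) hN hy (dist_comm y z ▸ h)
  rw [dist_comm z y] at h2
  exact abs_sub_le_iff.2 ⟨by linarith, by linarith⟩

/-- Points at distance at least `ε` are handled by the truncation: the oscillation is at most `N`,
hence at most `N / ε` times the distance. -/
theorem lipschitzOnWith_chainDist (hN : 0 ≤ N) (hε : 0 < ε) :
    LipschitzOnWith (max 1 (N / ε)).toNNReal (chainDist M ε x N) M := by
  refine LipschitzOnWith.of_dist_le_mul fun y hy z hz => ?_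
  rw [Real.coe_toNNReal _ (zero_le_one.trans (le_max_left _ _)), Real.dist_eq]
  rcases lt_or_ge (dist y z) ε with h | h
  · refine (abs_chainDist_sub_le hN hy hz h).trans ?_
    exact le_mul_of_one_le_left dist_nonneg (le_max_left _ _)
  · calc |chainDist M ε x N y - chainDist M ε x N z| ≤ N := by
          have h1 := chainDist_nonneg (M := M) (ε := ε) (x := x) (y := y) hN
          have h2 := chainDist_nonneg (M := M) (ε := ε) (x := x) (y := z) hN
          have h3 := chainDist_le (M := M) (ε := ε) (x := x) (y := y) hN
          have h4 := chainDist_le (M := M) (ε := ε) (x := x) (y := z) hN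
          exact abs_sub_le_iff.2 ⟨by linarith, by linarith⟩
      _ = N / ε * ε := by field_simp
      _ ≤ max 1 (N / ε) * dist y z := by
          gcongr
          exact le_max_right _ _

end ChainDist

/-! ### Quasiconvexity -/

theorem theorem5p5 (n : ℕ) (C_M C_P : ℝ) :
    ∃ κ : ℝ, ∀ M : Set (Euc (n + 1)),
      M ⊆ Metric.ball 0 1 →
      IsAhlforsRegularSet n C_M M →
      IsCountablyRectifiable n M →
      SatisfiesPoincare n C_P M →
      IsQuasiconvexSpace κ M := by
  obtain ⟨D, hD⟩ := exists_doubling_constant n C_M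
  -- The extra 1 makes the height `N` strictly larger than the Lipschitz bound, so the infimum at
  -- `y` is approached by a genuine chain.
  refine ⟨1 + 8 * (|D| * |C_P|), fun M hM hA _ hP => ⟨le_add_of_nonneg_right (by positivity),
    fun x y => ?_⟩⟩
  obtain ⟨hfin, hD0, hdoub⟩ := hD M hM hA
  rw [abs_of_nonneg hD0]
  have hcomp : IsCompact M := Metric.isCompact_of_isClosed_isBounded hA.isClosed
    (Metric.isBounded_ball.subset hM)
  refine hcomp.exists_path_of_forall_chain x y fun ε hε => ?_
  rcases eq_or_ne x y with rfl | hxy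
  · exact ⟨0, by simp, IsChainOfLength.refl⟩
  set d := dist (x : Euc (n + 1)) y with hd
  have hdpos : 0 < d := dist_pos.2 fun h => hxy (Subtype.ext h)
  set N := (1 + 8 * (D * |C_P|)) * d with hN
  have hN0 : 0 ≤ N := by positivity
  -- The Lipschitz constant of this extension may blow up as `ε → 0`; only the bound on its
  -- tangential gradient is used quantitatively.
  obtain ⟨f, hf, hfM⟩ :=
    (lipschitzOnWith_chainDist (M := M) (x := (x : Euc (n + 1))) hN0 hε).extend_real
  have hgrad : ∀ z ∈ M, ‖tangentialGradient n M f z‖ ≤ 1 := fun z hz =>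
    norm_tangentialGradient_le_one hf hε (fun u hu v hv huv => by
      rw [← hfM hu, ← hfM hv]
      exact abs_chainDist_sub_le hN0 hu hv huv) hz
  have hbound := abs_sub_le_of_norm_tangentialGradient_le_one hM hA.isClosed hP hD0 hdoub hf
    hgrad y.2 x.2
  rw [← hfM x.2, ← hfM y.2, chainDist_self hN0, sub_zero, dist_comm, ← hd] at hbound
  have hlt : chainDist M ε (x : Euc (n + 1)) N y < N :=
    ((le_abs_self _).trans hbound).trans_lt (by rw [hN]; linarith)
  obtain ⟨l, hl, hlN⟩ := exists_lt_of_csInf_lt (Set.insert_nonempty _ _) hlt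
  rcases hl with rfl | hl
  · exact absurd hlN (lt_irrefl _)
  · exact ⟨l, hlN.le, hl⟩
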